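/- Consider $A\in\mathbb{R}^{m\times n}$ ($n\ge 1$) of full row rank, $b\in\mathbb{R}^m$, $c\in\mathbb{R}^n$, and the strictly feasible set $\mathcal{F}_p^0=\{x : Ax=b,\ x>0\}$. Write $X=\mathrm{diag}(x)$ (likewise $Z$, $W$), $M_X=AX^2A^\top$, $e=(1,\dots,1)^\top$, $P_B=I-B^\top(BB^\top)^{-1}B$, $\|a\|_x=\|X^{-1}a\|$, where $\|\cdot\|$ is the Euclidean or the spectral norm. For $\mu>0$ and $x\in\mathcal{F}_p^0$ let $$v=\tfrac1\mu Xc-e,\qquad \Delta x=-XP_{AX}v,\qquad \delta(x,\mu)=\|P_{AX}v\|$$ be the residual vector, the primal projected Newton direction and the centrality proximity. For $\nu>0$ the thresholded scaled distance is $$\|y-z\|_{x,\nu}=\Big(\sum_{x_j\ge\nu}\big(\tfrac{y_j-z_j}{x_j}\big)^2+\sum_{x_j<\nu}(y_j-z_j)^2\Big)^{1/2}.$$ *Algorithm (one direction of delayed scaling).* Input: $A,c,\mu,\nu,\varepsilon,x,z$ and a cached lower triangular $L$ with $LL^\top=M_Z$. Put $w_j=z_j$ if $x_j\ge\nu$ and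 $w_j=x_j$ if $x_j<\nu$, and $u=W(\tfrac1\mu Wc-WX^{-1}e)$. Apply the conjugate gradient method, started at $0$ and preconditioned with $M_Z=LL^\top$ (by forward and backward substitution), to $AW^2A^\top d=Au$, until the residual $r$ satisfies $25\,r^\top M_Z^{-1}r\le\varepsilon^2$; with the resulting $\hat d$ return $\Delta\hat x=W^2A^\top\hat d-u$. (With an exact solve this would be the surrogate direction $-WP_{AW}(\tfrac1\mu Wc-WX^{-1}e)$.) The cost is the number of additions, subtractions, multiplications, divisions and comparisons of real numbers, in exact arithmetic. **Theorem.** There is a universal constant $C>0$ such that the following holds for all such $m,n,A,b,c$. Let $\nu\in(0,1]$, $\mu>0$, $\varepsilon>0$, $\lambda_z\ge 0$, let $x,z\in\mathcal{F}_p^0$, let $M_Z\succeq\lambda_z I$, let a lower triangular $L$ with $LL^\top=M_Z$ be given, and suppose $$\|z-x\|_{x,\nu}\le\min\Big\{\frac{\sqrt{\lambda_z}}{2\|A\|},\ \frac14,\ \frac{\varepsilon}{6\,\delta(x,\mu)}\Big\}$$ (a bound with denominator $0$ is void). Then the algorithm terminates and returns $\Delta\hat x$ with $$\|\Delta x-\Delta\hat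 x\|_x\le\varepsilon ,$$ and its cost $T$ satisfies $T\le C\,n^2\log\big(2+\|v\|/\varepsilon\big)$. Moreover, if $\varepsilon\le\tfrac12$, then $T\le C\log(2+\|v\|)\cdot n^2\log(1/\varepsilon)$; that is, $T=O(n^2\log(1/\varepsilon))$ with a hidden constant that depends only on the size $\|v\|$ of the residual vector. -/

import Mathlib

open scoped Matrix Matrix.Norms.L2Operator

noncomputable section

namespace PrimalIPM

/-! ### Norms, feasible set, projected Newton direction -/

/-- The Euclidean norm of a coordinate vector. -/
def euclNorm {n : ℕ} (v : Fin n → ℝ) : ℝ :=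
  ‖(WithLp.toLp 2 v : EuclideanSpace ℝ (Fin n))‖

/-- The scaled norm `‖a‖_x = ‖X⁻¹ a‖` with `X = diag x`. -/
def scaledNorm {n : ℕ} (x a : Fin n → ℝ) : ℝ :=
  euclNorm (fun j => (x j)⁻¹ * a j)

/-- The `ν`-thresholded scaled distance `‖y - z‖_{x,ν}`: coordinates with `x_j ≥ ν` are scaled
by `1 / x_j`, coordinates with `x_j < ν` are not scaled. -/
def thresholdedDist {n : ℕ} (x : Fin n → ℝ) (ν : ℝ) (y z : Fin n → ℝ) : ℝ :=
  Real.sqrt ((∑ j with ν ≤ x j, ((x j)⁻¹ * (y j - z j)) ^ 2) + ∑ j with x j < ν, (y j - z j) ^ 2)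

/-- The strictly feasible primal points `{x : A x = b, x > 0}`. -/
def strictlyFeasible {m n : ℕ} (A : Matrix (Fin m) (Fin n) ℝ) (b : Fin m → ℝ) :
    Set (Fin n → ℝ) :=
  {x | A *ᵥ x = b ∧ ∀ j, 0 < x j}

/-- The primal normal matrix `M_X = A X² Aᵀ`. -/
def normalMatrix {m n : ℕ} (A : Matrix (Fin m) (Fin n) ℝ) (x : Fin n → ℝ) :
    Matrix (Fin m) (Fin m) ℝ :=
  A * Matrix.diagonal x ^ 2 * Aᵀ

/-- The projection `P_B = I - Bᵀ (B Bᵀ)⁻¹ B` onto the kernel of a matrix `B` of full row rank. -/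
def kerProj {m n : ℕ} (B : Matrix (Fin m) (Fin n) ℝ) : Matrix (Fin n) (Fin n) ℝ :=
  1 - Bᵀ * (B * Bᵀ)⁻¹ * B

/-- The vector `(1/μ) X c - e`. -/
def barrierResidual {n : ℕ} (c x : Fin n → ℝ) (μ : ℝ) : Fin n → ℝ :=
  (1 / μ) • (Matrix.diagonal x *ᵥ c) - 1

/-- The projected Newton direction `Δx = - X P_{AX} ((1/μ) X c - e)`. -/
def newtonDirection {m n : ℕ} (A : Matrix (Fin m) (Fin n) ℝ) (c x : Fin n → ℝ) (μ : ℝ) :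
    Fin n → ℝ :=
  -(Matrix.diagonal x *ᵥ (kerProj (A * Matrix.diagonal x) *ᵥ barrierResidual c x μ))

/-- The proximity to the central path, `δ(x, μ) = ‖P_{AX} ((1/μ) X c - e)‖`. -/
def proximity {m n : ℕ} (A : Matrix (Fin m) (Fin n) ℝ) (c x : Fin n → ℝ) (μ : ℝ) : ℝ :=
  euclNorm (kerProj (A * Matrix.diagonal x) *ᵥ barrierResidual c x μ)

/-- `L` is a (Cholesky) triangular factor of `M`: lower triangular with `L Lᵀ = M`. -/
def IsTriangularFactor {m : ℕ} (L M : Matrix (Fin m) (Fin m) ℝ) : Prop :=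
  (∀ i j, i < j → L i j = 0) ∧ L * Lᵀ = M

/-! ### Counting arithmetic operations

Exact real arithmetic. Each addition, subtraction, multiplication, division and comparison of two
real numbers costs one operation. Only the five primitives below create or inspect reals in the
algorithm. -/

/-- A result together with the number of arithmetic operations spent on it. -/
structure Counted (α : Type) where
  val : α
  ops : ℕ

namespace Counted

instance : Monad Counted where
  pure a := ⟨a, 0⟩
  bind t f := ⟨(f t.val).val, t.ops + (f t.val).ops⟩

def add (a b : ℝ) : Counted ℝ := ⟨a + b, 1⟩

def sub (a b : ℝ) : Counted ℝ := ⟨a - b, 1⟩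

def mul (a b : ℝ) : Counted ℝ := ⟨a * b, 1⟩

def div (a b : ℝ) : Counted ℝ := ⟨a / b, 1⟩

def le (a b : ℝ) : Counted Bool := ⟨decide (a ≤ b), 1⟩

/-- Compute the entries of a vector one after the other. -/
def vec {n : ℕ} (f : Fin n → Counted ℝ) : Counted (Fin n → ℝ) :=
  ⟨fun i => (f i).val, ∑ i, (f i).ops⟩

/-- Compute `n` terms and add them up. -/
def sum : {n : ℕ} → (Fin n → Counted ℝ) → Counted ℝ
  | 0, _ => pure 0
  | _ + 1, f => do
    let s ← sum (fun i => f i.castSucc)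
    let t ← f (Fin.last _)
    add s t

def dot {n : ℕ} (u v : Fin n → ℝ) : Counted ℝ :=
  sum fun i => mul (u i) (v i)

def mulVec {m n : ℕ} (A : Matrix (Fin m) (Fin n) ℝ) (v : Fin n → ℝ) : Counted (Fin m → ℝ) :=
  vec fun i => dot (A i) v

/-- `u + a v`. -/
def axpy {n : ℕ} (u : Fin n → ℝ) (a : ℝ) (v : Fin n → ℝ) : Counted (Fin n → ℝ) :=
  vec fun i => do
    let t ← mul a (v i)
    add (u i) t

/-- Substitution for `T y = r`, determining the unknowns in the given order. Unknowns that are not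
yet determined are stored as `0`. -/
def substitute {m : ℕ} (T : Matrix (Fin m) (Fin m) ℝ) (order : List (Fin m)) (r : Fin m → ℝ) :
    Counted (Fin m → ℝ) :=
  order.foldlM (init := fun _ => 0) fun y i => do
    let s ← dot (T i) y
    let t ← sub (r i) s
    let q ← div t (T i i)
    pure (Function.update y i q)

/-- Solve `L Lᵀ s = r` for a lower triangular `L`: forward, then backward substitution. -/
def factorSolve {m : ℕ} (L : Matrix (Fin m) (Fin m) ℝ) (r : Fin m → ℝ) : Counted (Fin m → ℝ) := do
  let y ← substitute L (List.finRange m) r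
  substitute Lᵀ (List.finRange m).reverse y

/-! ### Preconditioned conjugate gradients -/

/-- `A diag(q) Aᵀ p`, without forming the matrix. -/
def applyNormal {m n : ℕ} (A : Matrix (Fin m) (Fin n) ℝ) (q : Fin n → ℝ) (p : Fin m → ℝ) :
    Counted (Fin m → ℝ) := do
  let t ← mulVec Aᵀ p
  let t ← vec fun j => mul (q j) (t j)
  mulVec A t

/-- Iterate of the preconditioned conjugate gradient method: approximate solution `d`, residual
`r`, search direction `p`, and `ρ = ⟨r, (L Lᵀ)⁻¹ r⟩`. -/
structure PCGState (m : ℕ) where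
  d : Fin m → ℝ
  r : Fin m → ℝ
  p : Fin m → ℝ
  ρ : ℝ

/-- Start of the method at `d = 0` for the right-hand side `h`. -/
def pcgInit {m : ℕ} (L : Matrix (Fin m) (Fin m) ℝ) (h : Fin m → ℝ) : Counted (PCGState m) := do
  let s ← factorSolve L h
  let ρ ← dot h s
  pure ⟨fun _ => 0, h, s, ρ⟩

/-- One step for the matrix `A diag(q) Aᵀ` with preconditioner `L Lᵀ`. -/
def pcgStep {m n : ℕ} (A : Matrix (Fin m) (Fin n) ℝ) (q : Fin n → ℝ)
    (L : Matrix (Fin m) (Fin m) ℝ) (st : PCGState m) : Counted (PCGState m) := do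
  let g ← applyNormal A q st.p
  let pg ← dot st.p g
  let α ← div st.ρ pg
  let d ← axpy st.d α st.p
  let a ← sub 0 α
  let r ← axpy st.r a g
  let s ← factorSolve L r
  let ρ ← dot r s
  let β ← div ρ st.ρ
  let p ← axpy s β st.p
  pure ⟨d, r, p, ρ⟩

/-- Repeat until `⟨r, (L Lᵀ)⁻¹ r⟩ ≤ (ε / 5)²`; `none` if this takes more than `maxIter` steps. -/
def pcgLoop {m n : ℕ} (A : Matrix (Fin m) (Fin n) ℝ) (q : Fin n → ℝ)
    (L : Matrix (Fin m) (Fin m) ℝ) (ε : ℝ) : ℕ → PCGState m → Counted (Option (Fin m → ℝ))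
  | maxIter, st => do
    let lhs ← mul 25 st.ρ
    let rhs ← mul ε ε
    let small ← le lhs rhs
    if small then
      pure (some st.d)
    else
      match maxIter with
      | 0 => pure none
      | k + 1 => do
        let st' ← pcgStep A q L st
        pcgLoop A q L ε k st'

end Counted

open Counted

/-! ### The surrogate direction of the delayed-scaling method -/

/-- The delayed scaling point: `w_j = z_j` where `x_j ≥ ν`, and `w_j = x_j` where `x_j < ν`. -/
def delayedPoint {n : ℕ} (ν : ℝ) (x z : Fin n → ℝ) : Counted (Fin n → ℝ) :=
  vec fun j => do
    let large ← le ν (x j)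
    pure (if large then z j else x j)

/-- The direction computed in one iteration of the primal interior point method with delayed
scaling, from a cached triangular factor `L` of `M_Z`. With `u = W ((1/μ) W c - W X⁻¹ e)` it solves
`A W² Aᵀ d = A u` approximately, by conjugate gradients preconditioned with `M_Z = L Lᵀ`, and
returns `W² Aᵀ d - u`. For the exact solution `d` this is
`- W P_{AW} ((1/μ) W c - W X⁻¹ e)`. -/
def delayedDirection {m n : ℕ} (A : Matrix (Fin m) (Fin n) ℝ) (c : Fin n → ℝ) (μ ν ε : ℝ)
    (x z : Fin n → ℝ) (L : Matrix (Fin m) (Fin m) ℝ) (maxIter : ℕ) :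
    Counted (Option (Fin n → ℝ)) := do
  let w ← delayedPoint ν x z
  let q ← vec fun j => mul (w j) (w j)
  let u ← vec fun j => do
    let a ← div (c j) μ
    let b ← div 1 (x j)
    let g ← sub a b
    mul (q j) g
  let h ← mulVec A u
  let st ← pcgInit L h
  let res ← pcgLoop A q L ε maxIter st
  match res with
  | none => pure none
  | some d => do
    let t ← mulVec Aᵀ d
    let dx ← vec fun j => do
      let s ← mul (q j) (t j)
      sub s (u j)
    pure (some dx)

end PrimalIPM

end

open PrimalIPM

/-!
Replacing `Z` by `W` changes `Z Aᵀ y` by at most `½ ‖Z Aᵀ y‖`, because `|w - z| ≤ √λ_z / (2 ‖A‖)`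
coordinatewise and `√λ_z ‖y‖ ≤ ‖Z Aᵀ y‖`. Hence `¼ M_Z ⪯ M_W ⪯ (9/4) M_Z`, and each step of
conjugate gradients preconditioned with `M_Z` does at least as well as a step of preconditioned
steepest descent: it multiplies the energy `⟨r, M_W⁻¹ r⟩` by at most `1 - (1/4) / (9/4) = 8/9`. The
energy starts below `((5/4) ‖v‖)²`, so `O(log (2 + ‖v‖ / ε))` steps of `O(n²)` operations reach the
stopping criterion. There the remaining residual displaces the direction by at most `ε / 2`, and
the exact surrogate direction is within `3 k δ(x, μ) ≤ ε / 2` of the Newton direction, where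
`k = ‖z - x‖_{x,ν}` bounds `|w / x - 1|`.
-/

namespace PrimalIPM

namespace Counted

section Operations

attribute [ext] Counted

attribute [simps] add sub mul div le

variable {α β : Type} {m n : ℕ}

@[simp] theorem pure_val (a : α) : (pure a : Counted α).val = a := rfl

@[simp] theorem pure_ops (a : α) : (pure a : Counted α).ops = 0 := rfl

@[simp] theorem bind_val (t : Counted α) (f : α → Counted β) :
    (t >>= f).val = (f t.val).val := rfl

@[simp] theorem bind_ops (t : Counted α) (f : α → Counted β) :
    (t >>= f).ops = t.ops + (f t.val).ops := rfl

@[simp] theorem vec_val (f : Fin n → Counted ℝ) : (vec f).val = fun i => (f i).val := rfl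

@[simp] theorem vec_ops (f : Fin n → Counted ℝ) : (vec f).ops = ∑ i, (f i).ops := rfl

@[simp] theorem sum_val (f : Fin n → Counted ℝ) : (sum f).val = ∑ i, (f i).val := by
  induction n with
  | zero => simp [sum]
  | succ n ih => simp [sum, ih, Fin.sum_univ_castSucc]

@[simp] theorem sum_ops (f : Fin n → Counted ℝ) : (sum f).ops = ∑ i, (f i).ops + n := by
  induction n with
  | zero => simp [sum]
  | succ n ih =>
    simp only [sum, bind_ops, add_ops, ih, Fin.sum_univ_castSucc]
    ring

@[simp] theorem dot_val (u v : Fin n → ℝ) : (dot u v).val = u ⬝ᵥ v := by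
  simp [dot, dotProduct]

@[simp] theorem dot_ops (u v : Fin n → ℝ) : (dot u v).ops = 2 * n := by
  simp [dot, two_mul]

@[simp] theorem mulVec_val (A : Matrix (Fin m) (Fin n) ℝ) (v : Fin n → ℝ) :
    (mulVec A v).val = A *ᵥ v := by
  ext i
  simp [mulVec, Matrix.mulVec]

@[simp] theorem mulVec_ops (A : Matrix (Fin m) (Fin n) ℝ) (v : Fin n → ℝ) :
    (mulVec A v).ops = 2 * m * n := by
  simp only [mulVec, vec_ops, dot_ops, Finset.sum_const, Finset.card_univ, Fintype.card_fin,
    smul_eq_mul]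
  ring

@[simp] theorem axpy_val (u : Fin n → ℝ) (a : ℝ) (v : Fin n → ℝ) :
    (axpy u a v).val = u + a • v := by
  ext i
  simp [axpy]

@[simp] theorem axpy_ops (u : Fin n → ℝ) (a : ℝ) (v : Fin n → ℝ) :
    (axpy u a v).ops = 2 * n := by
  simp [axpy, mul_comm]

theorem foldlM_val (f : β → α → Counted β) (l : List α) (b : β) :
    (l.foldlM f b).val = l.foldl (fun b a => (f b a).val) b := by
  induction l generalizing b with
  | nil => simp
  | cons a l ih => simp [ih]

theorem foldlM_ops {f : β → α → Counted β} {k : ℕ} (hf : ∀ b a, (f b a).ops = k)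
    (l : List α) (b : β) : (l.foldlM f b).ops = l.length * k := by
  induction l generalizing b with
  | nil => simp
  | cons a l ih =>
    simp only [List.foldlM_cons, bind_ops, hf, ih, List.length_cons]
    ring

@[simp] theorem substitute_ops (T : Matrix (Fin m) (Fin m) ℝ) (l : List (Fin m))
    (r : Fin m → ℝ) : (substitute T l r).ops = l.length * (2 * m + 2) :=
  foldlM_ops (fun _ _ => by simp) l _

@[simp] theorem factorSolve_ops (L : Matrix (Fin m) (Fin m) ℝ) (r : Fin m → ℝ) :
    (factorSolve L r).ops = 4 * m ^ 2 + 4 * m := by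
  simp only [factorSolve, bind_ops, substitute_ops, List.length_reverse, List.length_finRange]
  ring

@[simp] theorem applyNormal_val (A : Matrix (Fin m) (Fin n) ℝ) (q : Fin n → ℝ)
    (p : Fin m → ℝ) : (applyNormal A q p).val = (A * Matrix.diagonal q * Aᵀ) *ᵥ p := by
  simp only [applyNormal, bind_val, mulVec_val, vec_val, mul_val, ← Matrix.mulVec_mulVec]
  congr 1
  ext j
  rw [Matrix.mulVec_diagonal]

@[simp] theorem applyNormal_ops (A : Matrix (Fin m) (Fin n) ℝ) (q : Fin n → ℝ)
    (p : Fin m → ℝ) : (applyNormal A q p).ops = 4 * m * n + n := by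
  simp only [applyNormal, bind_ops, mulVec_ops, vec_ops, mul_ops, Finset.sum_const,
    Finset.card_univ, Fintype.card_fin, smul_eq_mul]
  ring

@[simp] theorem pcgInit_ops (L : Matrix (Fin m) (Fin m) ℝ) (h : Fin m → ℝ) :
    (pcgInit L h).ops = 4 * m ^ 2 + 6 * m := by
  simp only [pcgInit, bind_ops, factorSolve_ops, dot_ops, pure_ops]
  ring

@[simp] theorem pcgStep_ops (A : Matrix (Fin m) (Fin n) ℝ) (q : Fin n → ℝ)
    (L : Matrix (Fin m) (Fin m) ℝ) (st : PCGState m) :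
    (pcgStep A q L st).ops = 4 * m * n + n + 4 * m ^ 2 + 14 * m + 3 := by
  simp only [pcgStep, bind_ops, applyNormal_ops, dot_ops, div_ops, axpy_ops, sub_ops,
    factorSolve_ops, pure_ops]
  ring

end Operations

section Substitution

variable {m : ℕ} {T L : Matrix (Fin m) (Fin m) ℝ} {r : Fin m → ℝ}

/-- One step of `substitute`: solve row `i` of `T y = r` for the unknown `y i`. -/
noncomputable def substituteRow (T : Matrix (Fin m) (Fin m) ℝ) (r y : Fin m → ℝ) (i : Fin m) :
    Fin m → ℝ :=
  Function.update y i ((r i - T i ⬝ᵥ y) / T i i)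

theorem substitute_val (T : Matrix (Fin m) (Fin m) ℝ) (l : List (Fin m)) (r : Fin m → ℝ) :
    (substitute T l r).val = l.foldl (substituteRow T r) 0 := by
  rw [substitute, foldlM_val]
  simp only [bind_val, dot_val, sub_val, div_val, pure_val]
  rfl

theorem dotProduct_substituteRow (u : Fin m → ℝ) (y : Fin m → ℝ) (i : Fin m) :
    u ⬝ᵥ substituteRow T r y i = u ⬝ᵥ y + u i * ((r i - T i ⬝ᵥ y) / T i i - y i) := by
  have hupdate : substituteRow T r y i = y + Pi.single i ((r i - T i ⬝ᵥ y) / T i i - y i) := by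
    ext j
    rcases eq_or_ne j i with rfl | hj <;> simp [substituteRow, *]
  rw [hupdate, dotProduct_add, dotProduct_single]

theorem dotProduct_foldl_substituteRow_of_forall_eq_zero {u : Fin m → ℝ} {l : List (Fin m)}
    (hu : ∀ i ∈ l, u i = 0) (y : Fin m → ℝ) :
    u ⬝ᵥ l.foldl (substituteRow T r) y = u ⬝ᵥ y := by
  induction l generalizing y with
  | nil => rfl
  | cons i l ih =>
    rw [List.forall_mem_cons] at hu
    rw [List.foldl_cons, ih hu.2, dotProduct_substituteRow, hu.1, zero_mul, add_zero]

/-- A solved row stays solved, since the unknowns determined later do not occur in it. -/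
theorem dotProduct_foldl_substituteRow (hdiag : ∀ i, T i i ≠ 0) {l : List (Fin m)}
    (hl : l.Pairwise fun i j => i ≠ j ∧ T i j = 0) {y : Fin m → ℝ} (hy : ∀ i ∈ l, y i = 0) :
    ∀ i ∈ l, T i ⬝ᵥ l.foldl (substituteRow T r) y = r i := by
  induction l generalizing y with
  | nil => simp
  | cons i l ih =>
    obtain ⟨hi, hl⟩ := List.pairwise_cons.1 hl
    obtain ⟨hyi, hyl⟩ := List.forall_mem_cons.1 hy
    refine List.forall_mem_cons.2 ⟨?_, ih hl fun j hj => ?_⟩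
    · rw [List.foldl_cons, dotProduct_foldl_substituteRow_of_forall_eq_zero fun j hj => (hi j hj).2,
        dotProduct_substituteRow, hyi, sub_zero, mul_div_cancel₀ _ (hdiag i), add_sub_cancel]
    · rw [substituteRow, Function.update_of_ne (hi j hj).1.symm, hyl j hj]

theorem mulVec_substitute (hdiag : ∀ i, T i i ≠ 0) {l : List (Fin m)}
    (hl : l.Pairwise fun i j => i ≠ j ∧ T i j = 0) (hmem : ∀ i, i ∈ l) (r : Fin m → ℝ) :
    T *ᵥ (substitute T l r).val = r := by
  ext i
  rw [substitute_val]
  exact dotProduct_foldl_substituteRow hdiag hl (fun _ _ => rfl) i (hmem i)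

theorem mulVec_factorSolve (hL : ∀ i j, i < j → L i j = 0) (hdiag : ∀ i, L i i ≠ 0)
    (r : Fin m → ℝ) : (L * Lᵀ) *ᵥ (factorSolve L r).val = r := by
  have hforward : (List.finRange m).Pairwise fun i j => i ≠ j ∧ L i j = 0 :=
    (List.pairwise_lt_finRange m).imp fun h => ⟨h.ne, hL _ _ h⟩
  have hbackward : (List.finRange m).reverse.Pairwise fun i j => i ≠ j ∧ Lᵀ i j = 0 :=
    List.pairwise_reverse.2 ((List.pairwise_lt_finRange m).imp fun h => ⟨h.ne', hL _ _ h⟩)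
  rw [← Matrix.mulVec_mulVec, factorSolve, bind_val,
    mulVec_substitute (T := Lᵀ) hdiag hbackward (by simp),
    mulVec_substitute (T := L) hdiag hforward List.mem_finRange]

end Substitution

end Counted

open Counted

section LoewnerOrder

open scoped MatrixOrder

variable {ι : Type*} [Fintype ι] {M N : Matrix ι ι ℝ} {a b : ℝ}

theorem dotProduct_mulVec_comm (hM : M.IsHermitian) (x y : ι → ℝ) :
    x ⬝ᵥ M *ᵥ y = y ⬝ᵥ M *ᵥ x := by
  rw [Matrix.dotProduct_mulVec, ← Matrix.mulVec_transpose,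
    ← Matrix.conjTranspose_eq_transpose_of_trivial, hM, dotProduct_comm]

theorem loewner_le_iff (hM : M.IsHermitian) (hN : N.IsHermitian) :
    M ≤ N ↔ ∀ y, y ⬝ᵥ M *ᵥ y ≤ y ⬝ᵥ N *ᵥ y := by
  simp only [Matrix.le_iff, Matrix.posSemidef_iff_dotProduct_mulVec, hN.sub hM, true_and,
    star_trivial, Matrix.sub_mulVec, dotProduct_sub, sub_nonneg]

variable [DecidableEq ι]

theorem mulVec_inv_mulVec (hM : IsUnit M.det) (r : ι → ℝ) : M *ᵥ M⁻¹ *ᵥ r = r := by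
  rw [Matrix.mulVec_mulVec, Matrix.mul_nonsing_inv _ hM, Matrix.one_mulVec]

theorem inv_mulVec_mulVec (hM : IsUnit M.det) (r : ι → ℝ) : M⁻¹ *ᵥ M *ᵥ r = r := by
  rw [Matrix.mulVec_mulVec, Matrix.nonsing_inv_mul _ hM, Matrix.one_mulVec]

theorem isUnit_det_of_posDef (hM : M.PosDef) : IsUnit M.det :=
  (Matrix.isUnit_iff_isUnit_det M).1 hM.isUnit

/-- The squared dual norm `⟨r, M⁻¹ r⟩` of a positive definite matrix `M`. For the residual
`r = h - M d` of an approximate solution `d` it is the squared error of `d` in the energy norm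
of `M`. -/
noncomputable def dualNormSq (M : Matrix ι ι ℝ) (r : ι → ℝ) : ℝ :=
  r ⬝ᵥ M⁻¹ *ᵥ r

theorem dualNormSq_nonneg (hM : M.PosDef) (r : ι → ℝ) : 0 ≤ dualNormSq M r := by
  simpa [dualNormSq] using hM.inv.posSemidef.dotProduct_mulVec_nonneg r

theorem dualNormSq_sub (hM : M.PosDef) (r s : ι → ℝ) :
    dualNormSq M (r - M *ᵥ s) = dualNormSq M r - 2 * (s ⬝ᵥ r) + s ⬝ᵥ M *ᵥ s := by
  have hcross : (M *ᵥ s) ⬝ᵥ M⁻¹ *ᵥ r = s ⬝ᵥ r := by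
    rw [dotProduct_comm, dotProduct_mulVec_comm hM.1, mulVec_inv_mulVec (isUnit_det_of_posDef hM)]
  rw [dualNormSq, Matrix.mulVec_sub, inv_mulVec_mulVec (isUnit_det_of_posDef hM), sub_dotProduct,
    dotProduct_sub, dotProduct_sub, hcross, dotProduct_comm r s, dotProduct_comm (M *ᵥ s) s,
    dualNormSq]
  ring

theorem mul_dualNormSq_le_of_smul_le (hM : M.PosDef) (hN : N.PosDef) (ha : 0 ≤ a)
    (h : a • N ≤ M) (r : ι → ℝ) : a * dualNormSq M r ≤ dualNormSq N r := by
  have hNM := (loewner_le_iff (hN.1.smul (.all a)) hM.1).1 h (M⁻¹ *ᵥ r)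
  rw [Matrix.smul_mulVec, dotProduct_smul, smul_eq_mul,
    mulVec_inv_mulVec (isUnit_det_of_posDef hM)] at hNM
  have hsq := dualNormSq_nonneg hN (r - N *ᵥ (a • M⁻¹ *ᵥ r))
  rw [dualNormSq_sub hN, Matrix.mulVec_smul, dotProduct_smul, smul_dotProduct, smul_dotProduct,
    smul_eq_mul, smul_eq_mul, smul_eq_mul] at hsq
  rw [dualNormSq, dotProduct_comm]
  nlinarith [mul_le_mul_of_nonneg_left hNM ha]

theorem dualNormSq_le_mul_of_le_smul (hM : M.PosDef) (hN : N.PosDef) (hb : 0 < b)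
    (h : M ≤ b • N) (r : ι → ℝ) : dualNormSq N r ≤ b * dualNormSq M r := by
  have hMN : b⁻¹ • M ≤ N := by
    rw [loewner_le_iff (hM.1.smul (.all _)) hN.1]
    intro y
    have hy := (loewner_le_iff hM.1 (hN.1.smul (.all b))).1 h y
    rw [Matrix.smul_mulVec, dotProduct_smul, smul_eq_mul] at hy ⊢
    exact (inv_mul_le_iff₀ hb).2 hy
  exact (inv_mul_le_iff₀ hb).1 (mul_dualNormSq_le_of_smul_le hN hM (inv_pos.2 hb).le hMN r)

end LoewnerOrder

section TriangularFactor

variable {m : ℕ} {L N : Matrix (Fin m) (Fin m) ℝ}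

theorem IsTriangularFactor.diag_ne_zero (hL : IsTriangularFactor L N) (hN : IsUnit N.det)
    (i : Fin m) : L i i ≠ 0 := by
  have hdet : N.det = (∏ i, L i i) * ∏ i, L i i := by
    rw [← hL.2, Matrix.det_mul, Matrix.det_transpose,
      Matrix.det_of_isLowerTriangular L fun i j hij => hL.1 _ _ hij]
  rw [hdet] at hN
  exact Finset.prod_ne_zero_iff.1 (left_ne_zero_of_mul hN.ne_zero) i (Finset.mem_univ i)

theorem Counted.factorSolve_val (hL : IsTriangularFactor L N) (hN : IsUnit N.det) (r : Fin m → ℝ) :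
    (factorSolve L r).val = N⁻¹ *ᵥ r := by
  rw [← inv_mulVec_mulVec hN (factorSolve L r).val]
  nth_rw 2 [← hL.2]
  rw [mulVec_factorSolve hL.1 (hL.diag_ne_zero hN)]

end TriangularFactor

section ConjugateGradients

variable {m n : ℕ} {M N : Matrix (Fin m) (Fin m) ℝ} {h : Fin m → ℝ} {st : PCGState m}

/-- One exact step of the conjugate gradient method for the matrix `M` with preconditioner `N`:
the state that `Counted.pcgStep` computes. -/
noncomputable def pcgNext (M N : Matrix (Fin m) (Fin m) ℝ) (st : PCGState m) : PCGState m :=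
  let α := st.ρ / (st.p ⬝ᵥ M *ᵥ st.p)
  let r := st.r - M *ᵥ (α • st.p)
  ⟨st.d + α • st.p, r, N⁻¹ *ᵥ r + (dualNormSq N r / st.ρ) • st.p, dualNormSq N r⟩

theorem Counted.pcgStep_val {A : Matrix (Fin m) (Fin n) ℝ} {q : Fin n → ℝ}
    {L : Matrix (Fin m) (Fin m) ℝ} (hL : IsTriangularFactor L N) (hN : IsUnit N.det)
    (st : PCGState m) :
    (pcgStep A q L st).val = pcgNext (A * Matrix.diagonal q * Aᵀ) N st := by
  simp only [pcgStep, pcgNext, bind_val, pure_val, applyNormal_val, dot_val, div_val, axpy_val,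
    sub_val, zero_sub, factorSolve_val hL hN, neg_smul, ← sub_eq_add_neg, Matrix.mulVec_smul,
    dualNormSq]

/-- The relations between the parts of an iterate of the preconditioned conjugate gradient method
for `M d = h` with preconditioner `N`. Conjugacy is recorded only between the current and the
previous direction, in the form that survives at the first iterate; this suffices for linear
convergence. -/
structure IsPCGIterate (M N : Matrix (Fin m) (Fin m) ℝ) (h : Fin m → ℝ) (st : PCGState m) :
    Prop where
  residual : st.r = h - M *ᵥ st.d
  rho_eq : st.ρ = dualNormSq N st.r
  direction_residual : st.p ⬝ᵥ st.r = st.ρ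
  conjugate : (N⁻¹ *ᵥ st.r) ⬝ᵥ M *ᵥ st.p = st.p ⬝ᵥ M *ᵥ st.p
  curvature_le : st.p ⬝ᵥ M *ᵥ st.p ≤ (N⁻¹ *ᵥ st.r) ⬝ᵥ M *ᵥ (N⁻¹ *ᵥ st.r)

theorem isPCGIterate_pcgInit {L : Matrix (Fin m) (Fin m) ℝ} (hL : IsTriangularFactor L N)
    (hN : IsUnit N.det) (M : Matrix (Fin m) (Fin m) ℝ) (h : Fin m → ℝ) :
    IsPCGIterate M N h (pcgInit L h).val := by
  have hzero : (fun _ => 0 : Fin m → ℝ) = 0 := rfl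
  constructor <;> simp [pcgInit, factorSolve_val hL hN, hzero, dualNormSq, dotProduct_comm h]

namespace IsPCGIterate

theorem curvature_pos (hst : IsPCGIterate M N h st) (hM : M.PosDef) (hρ : 0 < st.ρ) :
    0 < st.p ⬝ᵥ M *ᵥ st.p := by
  have hp : st.p ≠ 0 := fun hp =>
    hρ.ne (by rw [← hst.direction_residual, hp, zero_dotProduct])
  simpa using hM.dotProduct_mulVec_pos hp

theorem direction_dotProduct_pcgNext_r (hst : IsPCGIterate M N h st)
    (hκ : st.p ⬝ᵥ M *ᵥ st.p ≠ 0) : st.p ⬝ᵥ (pcgNext M N st).r = 0 := by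
  rw [pcgNext, dotProduct_sub, Matrix.mulVec_smul, dotProduct_smul, smul_eq_mul,
    div_mul_cancel₀ _ hκ, hst.direction_residual, sub_self]

theorem residual_dotProduct_inv_mulVec_pcgNext_r (hst : IsPCGIterate M N h st)
    (hN : N.IsHermitian) (hκ : st.p ⬝ᵥ M *ᵥ st.p ≠ 0) :
    st.r ⬝ᵥ N⁻¹ *ᵥ (pcgNext M N st).r = 0 := by
  rw [dotProduct_mulVec_comm hN.inv, dotProduct_comm, pcgNext, dotProduct_sub,
    Matrix.mulVec_smul, dotProduct_smul, hst.conjugate, smul_eq_mul, div_mul_cancel₀ _ hκ,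
    hst.rho_eq, dotProduct_comm, dualNormSq, sub_self]

theorem inv_mulVec_pcgNext_r_dotProduct (hst : IsPCGIterate M N h st) (hN : N.IsHermitian)
    (hκ : st.p ⬝ᵥ M *ᵥ st.p ≠ 0) (hρ : st.ρ ≠ 0) :
    (N⁻¹ *ᵥ (pcgNext M N st).r) ⬝ᵥ M *ᵥ st.p =
      -((pcgNext M N st).ρ / st.ρ * (st.p ⬝ᵥ M *ᵥ st.p)) := by
  have hstep : (pcgNext M N st).ρ =
      -(st.ρ / (st.p ⬝ᵥ M *ᵥ st.p)) * ((N⁻¹ *ᵥ (pcgNext M N st).r) ⬝ᵥ M *ᵥ st.p) := by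
    calc (pcgNext M N st).ρ
        = (N⁻¹ *ᵥ (pcgNext M N st).r) ⬝ᵥ (pcgNext M N st).r := by
          rw [dotProduct_comm]
          rfl
      _ = (N⁻¹ *ᵥ (pcgNext M N st).r) ⬝ᵥ
            (st.r - (st.ρ / (st.p ⬝ᵥ M *ᵥ st.p)) • M *ᵥ st.p) := by
          rw [← Matrix.mulVec_smul]
          rfl
      _ = _ := by
          rw [dotProduct_sub, dotProduct_comm _ st.r,
            hst.residual_dotProduct_inv_mulVec_pcgNext_r hN hκ, dotProduct_smul, smul_eq_mul,
            zero_sub, neg_mul]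
  rw [hstep]
  field_simp

theorem pcgNext_p_dotProduct (hst : IsPCGIterate M N h st) (hN : N.IsHermitian)
    (hκ : st.p ⬝ᵥ M *ᵥ st.p ≠ 0) (hρ : st.ρ ≠ 0) :
    (pcgNext M N st).p ⬝ᵥ M *ᵥ st.p = 0 := by
  have hp : (pcgNext M N st).p =
      N⁻¹ *ᵥ (pcgNext M N st).r + ((pcgNext M N st).ρ / st.ρ) • st.p := rfl
  rw [hp, add_dotProduct, smul_dotProduct, hst.inv_mulVec_pcgNext_r_dotProduct hN hκ hρ,
    smul_eq_mul, neg_add_cancel]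

theorem next (hst : IsPCGIterate M N h st) (hM : M.PosDef) (hN : N.IsHermitian)
    (hρ : 0 < st.ρ) : IsPCGIterate M N h (pcgNext M N st) := by
  have hκ := hst.curvature_pos hM hρ
  have hpp := hst.pcgNext_p_dotProduct hN hκ.ne' hρ.ne'
  have hsp := hst.inv_mulVec_pcgNext_r_dotProduct hN hκ.ne' hρ.ne'
  have hpr := hst.direction_dotProduct_pcgNext_r hκ.ne'
  have hr : (pcgNext M N st).r = h - M *ᵥ (pcgNext M N st).d := by
    rw [pcgNext, Matrix.mulVec_add, hst.residual, sub_sub]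
  have hp : (pcgNext M N st).p = N⁻¹ *ᵥ (pcgNext M N st).r +
      ((pcgNext M N st).ρ / st.ρ) • st.p := rfl
  have hρ' : (pcgNext M N st).ρ = dualNormSq N (pcgNext M N st).r := rfl
  generalize pcgNext M N st = st' at *
  have hconj : (N⁻¹ *ᵥ st'.r) ⬝ᵥ M *ᵥ st'.p = st'.p ⬝ᵥ M *ᵥ st'.p := by
    nth_rw 2 [hp]
    rw [add_dotProduct, smul_dotProduct, dotProduct_mulVec_comm hM.1 st.p, hpp, smul_zero,
      add_zero]
  refine ⟨hr, hρ', ?_, hconj, ?_⟩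
  · rw [hp, add_dotProduct, smul_dotProduct, hpr, smul_zero, add_zero, dotProduct_comm, hρ',
      dualNormSq]
  · have hexpand : st'.p ⬝ᵥ M *ᵥ st'.p = (N⁻¹ *ᵥ st'.r) ⬝ᵥ M *ᵥ (N⁻¹ *ᵥ st'.r) -
        (st'.ρ / st.ρ) ^ 2 * (st.p ⬝ᵥ M *ᵥ st.p) := by
      rw [← hconj, hp, Matrix.mulVec_add, Matrix.mulVec_smul, dotProduct_add, dotProduct_smul, hsp,
        smul_eq_mul]
      ring
    rw [hexpand]
    exact sub_le_self _ (mul_nonneg (sq_nonneg _) hκ.le)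

theorem dualNormSq_pcgNext_r (hst : IsPCGIterate M N h st) (hM : M.PosDef) (hρ : 0 < st.ρ) :
    dualNormSq M (pcgNext M N st).r =
      dualNormSq M st.r - st.ρ ^ 2 / (st.p ⬝ᵥ M *ᵥ st.p) := by
  have hκ := hst.curvature_pos hM hρ
  rw [pcgNext, dualNormSq_sub hM, Matrix.mulVec_smul, dotProduct_smul, smul_dotProduct,
    smul_dotProduct, hst.direction_residual, smul_eq_mul, smul_eq_mul, smul_eq_mul]
  field_simp
  ring

open scoped MatrixOrder in
theorem dualNormSq_pcgNext_r_le (hst : IsPCGIterate M N h st) (hM : M.PosDef) (hN : N.PosDef)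
    {a b : ℝ} (ha : 0 ≤ a) (hb : 0 < b) (hNM : a • N ≤ M) (hMN : M ≤ b • N) (hρ : 0 < st.ρ) :
    dualNormSq M (pcgNext M N st).r ≤ (1 - a / b) * dualNormSq M st.r := by
  have hκ := hst.curvature_pos hM hρ
  have henergy : a * dualNormSq M st.r ≤ st.ρ :=
    (mul_dualNormSq_le_of_smul_le hM hN ha hNM st.r).trans_eq hst.rho_eq.symm
  have hcurvature : st.p ⬝ᵥ M *ᵥ st.p ≤ b * st.ρ :=
    calc st.p ⬝ᵥ M *ᵥ st.p
        ≤ (N⁻¹ *ᵥ st.r) ⬝ᵥ M *ᵥ (N⁻¹ *ᵥ st.r) := hst.curvature_le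
      _ ≤ (N⁻¹ *ᵥ st.r) ⬝ᵥ (b • N) *ᵥ (N⁻¹ *ᵥ st.r) :=
          (loewner_le_iff hM.1 (hN.1.smul (.all b))).1 hMN _
      _ = b * st.ρ := by
          rw [Matrix.smul_mulVec, dotProduct_smul, smul_eq_mul,
            mulVec_inv_mulVec (isUnit_det_of_posDef hN), dotProduct_comm, hst.rho_eq, dualNormSq]
  have hdecrease : a / b * dualNormSq M st.r ≤ st.ρ ^ 2 / (st.p ⬝ᵥ M *ᵥ st.p) := by
    rw [div_mul_eq_mul_div, div_le_div_iff₀ hb hκ]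
    calc a * dualNormSq M st.r * (st.p ⬝ᵥ M *ᵥ st.p)
        ≤ st.ρ * (b * st.ρ) := mul_le_mul henergy hcurvature hκ.le hρ.le
      _ = st.ρ ^ 2 * b := by ring
  rw [hst.dualNormSq_pcgNext_r hM hρ]
  linarith

end IsPCGIterate

end ConjugateGradients

section Loop

variable {m n : ℕ} {A : Matrix (Fin m) (Fin n) ℝ} {q : Fin n → ℝ}
  {L N : Matrix (Fin m) (Fin m) ℝ} {h : Fin m → ℝ} {ε : ℝ}

theorem Counted.pcgLoop_of_le {st : PCGState m} (hst : 25 * st.ρ ≤ ε * ε) (k : ℕ) :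
    pcgLoop A q L ε k st = ⟨some st.d, 3⟩ := by
  unfold pcgLoop
  ext <;> simp [hst]

theorem Counted.pcgLoop_succ_of_lt {st : PCGState m} (hst : ε * ε < 25 * st.ρ)
    (k : ℕ) :
    pcgLoop A q L ε (k + 1) st =
      ⟨(pcgLoop A q L ε k (pcgStep A q L st).val).val,
        4 * m * n + n + 4 * m ^ 2 + 14 * m + 6 +
          (pcgLoop A q L ε k (pcgStep A q L st).val).ops⟩ := by
  conv_lhs => unfold pcgLoop
  ext
  · simp [hst.not_ge]
  · simp only [bind_ops, mul_ops, mul_val, le_ops, le_val, hst.not_ge, decide_false,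
      Bool.false_eq_true, if_false, pcgStep_ops]
    ring

open scoped MatrixOrder in
theorem IsPCGIterate.exists_pcgLoop_eq (hM : (A * Matrix.diagonal q * Aᵀ).PosDef)
    (hN : N.PosDef) (hL : IsTriangularFactor L N) {a b : ℝ} (ha : 0 ≤ a) (hb : 0 < b)
    (hab : a ≤ b) (hNM : a • N ≤ A * Matrix.diagonal q * Aᵀ)
    (hMN : A * Matrix.diagonal q * Aᵀ ≤ b • N) {K : ℕ} {st : PCGState m}
    (hst : IsPCGIterate (A * Matrix.diagonal q * Aᵀ) N h st)
    (hK : 25 * b * ((1 - a / b) ^ K * dualNormSq (A * Matrix.diagonal q * Aᵀ) st.r) ≤ ε ^ 2) :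
    ∃ (d : Fin m → ℝ) (T : ℕ),
      (∀ maxIter, K ≤ maxIter → pcgLoop A q L ε maxIter st = ⟨some d, T⟩) ∧
      T ≤ 3 + K * (4 * m * n + n + 4 * m ^ 2 + 14 * m + 6) ∧
      25 * dualNormSq N (h - (A * Matrix.diagonal q * Aᵀ) *ᵥ d) ≤ ε ^ 2 := by
  rcases le_or_gt (25 * st.ρ) (ε * ε) with hsmall | hlarge
  · refine ⟨st.d, 3, fun k _ => pcgLoop_of_le hsmall k, Nat.le_add_right _ _, ?_⟩
    rwa [← hst.residual, ← hst.rho_eq, sq]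
  cases K with
  | zero =>
    have hρ := dualNormSq_le_mul_of_le_smul hM hN hb hMN st.r
    rw [← hst.rho_eq] at hρ
    linarith
  | succ K =>
    have hρ : 0 < st.ρ := by linarith [mul_self_nonneg ε]
    have hcontract := hst.dualNormSq_pcgNext_r_le hM hN ha hb hNM hMN hρ
    have hrate : 0 ≤ 1 - a / b := sub_nonneg.2 (div_le_one_of_le₀ hab hb.le)
    obtain ⟨d, T, hrun, hT, hres⟩ :=
      exists_pcgLoop_eq hM hN hL ha hb hab hNM hMN (K := K) (hst.next hM hN.1 hρ) <| by
        refine le_trans ?_ hK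
        rw [pow_succ, mul_assoc (_ ^ K)]
        gcongr
    refine ⟨d, 4 * m * n + n + 4 * m ^ 2 + 14 * m + 6 + T, fun k hk => ?_, ?_, hres⟩
    · obtain ⟨k, rfl⟩ := Nat.exists_eq_add_of_le' (Nat.one_le_of_lt hk)
      rw [pcgLoop_succ_of_lt hlarge, pcgStep_val hL (isUnit_det_of_posDef hN),
        hrun k (Nat.le_of_succ_le_succ hk)]
    · rw [add_mul]
      omega

end Loop

section EuclideanNorm

variable {m n : ℕ}

theorem euclNorm_nonneg (v : Fin n → ℝ) : 0 ≤ euclNorm v := norm_nonneg _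

theorem euclNorm_sq (v : Fin n → ℝ) : euclNorm v ^ 2 = v ⬝ᵥ v := by
  rw [euclNorm, EuclideanSpace.real_norm_sq_eq]
  simp [dotProduct, sq]

theorem euclNorm_add_sq_of_dotProduct_eq_zero {u v : Fin n → ℝ} (h : u ⬝ᵥ v = 0) :
    euclNorm (u + v) ^ 2 = euclNorm u ^ 2 + euclNorm v ^ 2 := by
  rw [euclNorm_sq, add_dotProduct, dotProduct_add, dotProduct_add, dotProduct_comm v u, h, add_zero,
    zero_add, euclNorm_sq, euclNorm_sq]

theorem euclNorm_add_le (u v : Fin n → ℝ) : euclNorm (u + v) ≤ euclNorm u + euclNorm v := by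
  rw [euclNorm, WithLp.toLp_add]
  exact norm_add_le _ _

theorem abs_euclNorm_sub_le (u v : Fin n → ℝ) : |euclNorm u - euclNorm v| ≤ euclNorm (u - v) := by
  rw [euclNorm, euclNorm, euclNorm, WithLp.toLp_sub]
  exact abs_norm_sub_norm_le _ _

theorem euclNorm_mul_le {d : Fin n → ℝ} {k : ℝ} (hk : 0 ≤ k) (hd : ∀ j, |d j| ≤ k)
    (a : Fin n → ℝ) : euclNorm (d * a) ≤ k * euclNorm a := by
  rw [← sq_le_sq₀ (euclNorm_nonneg _) (mul_nonneg hk (euclNorm_nonneg _)), mul_pow, euclNorm_sq,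
    euclNorm_sq, dotProduct, dotProduct, Finset.mul_sum]
  refine Finset.sum_le_sum fun j _ => ?_
  calc d j * a j * (d j * a j) = |d j| ^ 2 * (a j * a j) := by rw [sq_abs]; ring
    _ ≤ k ^ 2 * (a j * a j) := by
      gcongr
      exacts [mul_self_nonneg _, hd j]

theorem euclNorm_transpose_mulVec_le (A : Matrix (Fin m) (Fin n) ℝ) (y : Fin m → ℝ) :
    euclNorm (Aᵀ *ᵥ y) ≤ ‖A‖ * euclNorm y := by
  have h := Matrix.l2_opNorm_mulVec Aᵀ (WithLp.toLp 2 y)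
  rwa [← Matrix.conjTranspose_eq_transpose_of_trivial, Matrix.l2_opNorm_conjTranspose] at h

theorem euclNorm_transpose_mulVec_sq (B : Matrix (Fin m) (Fin n) ℝ) (y : Fin m → ℝ) :
    euclNorm (Bᵀ *ᵥ y) ^ 2 = y ⬝ᵥ (B * Bᵀ) *ᵥ y := by
  rw [euclNorm_sq, ← Matrix.mulVec_mulVec, Matrix.dotProduct_mulVec y, Matrix.mulVec_transpose]

theorem scaledNorm_sub_le (x u v w : Fin n → ℝ) :
    scaledNorm x (u - w) ≤ scaledNorm x (u - v) + scaledNorm x (v - w) := by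
  refine le_of_eq_of_le (congrArg euclNorm ?_) (euclNorm_add_le _ _)
  ext j
  simp only [Pi.sub_apply, Pi.add_apply]
  ring

end EuclideanNorm

section Projection

variable {m n : ℕ} {B : Matrix (Fin m) (Fin n) ℝ}

theorem kerProj_mulVec (B : Matrix (Fin m) (Fin n) ℝ) (a : Fin n → ℝ) :
    kerProj B *ᵥ a = a - Bᵀ *ᵥ (B * Bᵀ)⁻¹ *ᵥ B *ᵥ a := by
  rw [kerProj, Matrix.sub_mulVec, Matrix.one_mulVec, ← Matrix.mulVec_mulVec,
    ← Matrix.mulVec_mulVec]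

theorem mulVec_kerProj_mulVec (hB : IsUnit (B * Bᵀ).det) (a : Fin n → ℝ) :
    B *ᵥ kerProj B *ᵥ a = 0 := by
  rw [kerProj_mulVec, Matrix.mulVec_sub, Matrix.mulVec_mulVec, mulVec_inv_mulVec hB, sub_self]

theorem kerProj_mulVec_of_mulVec_eq_zero {a : Fin n → ℝ} (ha : B *ᵥ a = 0) :
    kerProj B *ᵥ a = a := by
  rw [kerProj_mulVec, ha, Matrix.mulVec_zero, Matrix.mulVec_zero, sub_zero]

theorem kerProj_mulVec_transpose_mulVec (hB : IsUnit (B * Bᵀ).det) (y : Fin m → ℝ) :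
    kerProj B *ᵥ Bᵀ *ᵥ y = 0 := by
  rw [kerProj_mulVec, Matrix.mulVec_mulVec _ B, inv_mulVec_mulVec hB, sub_self]

theorem euclNorm_transpose_inv_mulVec_sq (hB : IsUnit (B * Bᵀ).det) (r : Fin m → ℝ) :
    euclNorm (Bᵀ *ᵥ (B * Bᵀ)⁻¹ *ᵥ r) ^ 2 = dualNormSq (B * Bᵀ) r := by
  rw [euclNorm_transpose_mulVec_sq, mulVec_inv_mulVec hB, dotProduct_comm, dualNormSq]

theorem euclNorm_kerProj_mulVec_sq_add (hB : IsUnit (B * Bᵀ).det) (a : Fin n → ℝ) :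
    euclNorm (kerProj B *ᵥ a) ^ 2 + dualNormSq (B * Bᵀ) (B *ᵥ a) = euclNorm a ^ 2 := by
  have horth : (kerProj B *ᵥ a) ⬝ᵥ Bᵀ *ᵥ (B * Bᵀ)⁻¹ *ᵥ B *ᵥ a = 0 := by
    rw [dotProduct_comm, Matrix.mulVec_transpose, ← Matrix.dotProduct_mulVec,
      mulVec_kerProj_mulVec hB, dotProduct_zero]
  have hsplit : kerProj B *ᵥ a + Bᵀ *ᵥ (B * Bᵀ)⁻¹ *ᵥ B *ᵥ a = a := by
    rw [kerProj_mulVec, sub_add_cancel]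
  rw [← euclNorm_transpose_inv_mulVec_sq hB, ← euclNorm_add_sq_of_dotProduct_eq_zero horth, hsplit]

theorem euclNorm_kerProj_mulVec_le (hB : IsUnit (B * Bᵀ).det) (a : Fin n → ℝ) :
    euclNorm (kerProj B *ᵥ a) ≤ euclNorm a := by
  rw [← sq_le_sq₀ (euclNorm_nonneg _) (euclNorm_nonneg _), ← euclNorm_kerProj_mulVec_sq_add hB a,
    ← euclNorm_transpose_inv_mulVec_sq hB]
  exact le_add_of_nonneg_right (sq_nonneg _)

theorem dualNormSq_mulVec_le (hB : IsUnit (B * Bᵀ).det) (a : Fin n → ℝ) :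
    dualNormSq (B * Bᵀ) (B *ᵥ a) ≤ euclNorm a ^ 2 := by
  rw [← euclNorm_kerProj_mulVec_sq_add hB]
  exact le_add_of_nonneg_left (sq_nonneg _)

theorem mul_diagonal_mulVec (B : Matrix (Fin m) (Fin n) ℝ) (d a : Fin n → ℝ) :
    (B * Matrix.diagonal d) *ᵥ a = B *ᵥ (d * a) := by
  rw [← Matrix.mulVec_mulVec]
  congr 1
  ext j
  rw [Matrix.mulVec_diagonal, Pi.mul_apply]

theorem transpose_mul_diagonal_mulVec (B : Matrix (Fin m) (Fin n) ℝ) (d : Fin n → ℝ)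
    (y : Fin m → ℝ) : (B * Matrix.diagonal d)ᵀ *ᵥ y = d * (Bᵀ *ᵥ y) := by
  rw [Matrix.transpose_mul, Matrix.diagonal_transpose, ← Matrix.mulVec_mulVec]
  ext j
  rw [Matrix.mulVec_diagonal, Pi.mul_apply]

/-- Comparing projected directions at two scalings: rescaling the columns of `B` by `d` changes
`P_B a` only through `(d - d⁻¹) P_B a`, because `d⁻¹ P_B a` is still in the kernel and
`d (a - P_B a)` is still in the row space. -/
theorem mul_kerProj_mul_diagonal_mulVec_sub {d : Fin n → ℝ} (hd : ∀ j, d j ≠ 0)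
    (hB : IsUnit (B * Bᵀ).det)
    (hBd : IsUnit (B * Matrix.diagonal d * (B * Matrix.diagonal d)ᵀ).det) (a : Fin n → ℝ) :
    d * (kerProj (B * Matrix.diagonal d) *ᵥ (d * a)) - kerProj B *ᵥ a =
      d * (kerProj (B * Matrix.diagonal d) *ᵥ ((d - d⁻¹) * (kerProj B *ᵥ a))) := by
  have hcancel : d * d⁻¹ = 1 := funext fun j => mul_inv_cancel₀ (hd j)
  have hfixed : kerProj (B * Matrix.diagonal d) *ᵥ (d⁻¹ * (kerProj B *ᵥ a)) =
      d⁻¹ * (kerProj B *ᵥ a) := by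
    apply kerProj_mulVec_of_mulVec_eq_zero
    rw [mul_diagonal_mulVec, ← mul_assoc, hcancel, one_mul, mulVec_kerProj_mulVec hB]
  have hsplit : d * a = (d - d⁻¹) * (kerProj B *ᵥ a) + d⁻¹ * (kerProj B *ᵥ a) +
      (B * Matrix.diagonal d)ᵀ *ᵥ (B * Bᵀ)⁻¹ *ᵥ B *ᵥ a := by
    rw [transpose_mul_diagonal_mulVec, kerProj_mulVec]
    ring
  rw [hsplit, Matrix.mulVec_add, Matrix.mulVec_add, hfixed, kerProj_mulVec_transpose_mulVec hBd,
    add_zero, mul_add, ← mul_assoc d d⁻¹, hcancel, one_mul, add_sub_cancel_right]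

end Projection

section NormalMatrix

open scoped MatrixOrder

variable {m n : ℕ} {A : Matrix (Fin m) (Fin n) ℝ} {w z : Fin n → ℝ}

theorem normalMatrix_eq_mul_transpose (A : Matrix (Fin m) (Fin n) ℝ) (w : Fin n → ℝ) :
    normalMatrix A w = A * Matrix.diagonal w * (A * Matrix.diagonal w)ᵀ := by
  rw [normalMatrix, sq, Matrix.transpose_mul, Matrix.diagonal_transpose]
  simp only [Matrix.mul_assoc]

theorem normalMatrix_eq_mul_diagonal_mul (A : Matrix (Fin m) (Fin n) ℝ) (w : Fin n → ℝ) :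
    normalMatrix A w = A * Matrix.diagonal (w * w) * Aᵀ := by
  rw [normalMatrix, sq, Matrix.diagonal_mul_diagonal]
  rfl

theorem normalMatrix_isHermitian (A : Matrix (Fin m) (Fin n) ℝ) (w : Fin n → ℝ) :
    (normalMatrix A w).IsHermitian := by
  rw [normalMatrix_eq_mul_transpose]
  exact Matrix.isHermitian_mul_conjTranspose_self _

theorem dotProduct_normalMatrix_mulVec (A : Matrix (Fin m) (Fin n) ℝ) (w : Fin n → ℝ)
    (y : Fin m → ℝ) : y ⬝ᵥ normalMatrix A w *ᵥ y = euclNorm (w * (Aᵀ *ᵥ y)) ^ 2 := by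
  rw [normalMatrix_eq_mul_transpose, ← euclNorm_transpose_mulVec_sq, transpose_mul_diagonal_mulVec]

theorem normalMatrix_posDef (hA : A.rank = m) (hw : ∀ j, w j ≠ 0) : (normalMatrix A w).PosDef := by
  have hinj : Function.Injective A.vecMul := by
    rw [Matrix.vecMul_injective_iff, linearIndependent_iff_card_eq_finrank_span,
      Fintype.card_fin, Set.finrank, ← Matrix.rank_eq_finrank_span_row, hA]
  rw [normalMatrix_eq_mul_diagonal_mul]
  exact (Matrix.PosDef.diagonal fun j => mul_self_pos.2 (hw j)).mul_mul_conjTranspose_same hinj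

theorem isUnit_det_mul_diagonal (hA : A.rank = m) (hw : ∀ j, w j ≠ 0) :
    IsUnit (A * Matrix.diagonal w * (A * Matrix.diagonal w)ᵀ).det := by
  rw [← normalMatrix_eq_mul_transpose]
  exact isUnit_det_of_posDef (normalMatrix_posDef hA hw)

theorem sqrt_mul_euclNorm_le {lam : ℝ} (hlam : 0 ≤ lam) (hz : lam • 1 ≤ normalMatrix A z)
    (y : Fin m → ℝ) : √lam * euclNorm y ≤ euclNorm (z * (Aᵀ *ᵥ y)) := by
  rw [← sq_le_sq₀ (mul_nonneg (Real.sqrt_nonneg _) (euclNorm_nonneg _)) (euclNorm_nonneg _),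
    mul_pow, Real.sq_sqrt hlam, ← dotProduct_normalMatrix_mulVec, euclNorm_sq]
  simpa [Matrix.smul_mulVec] using (loewner_le_iff (Matrix.isHermitian_one.smul (.all lam))
    (normalMatrix_isHermitian A z)).1 hz y

theorem abs_euclNorm_mul_transpose_mulVec_sub_le {k lam θ : ℝ} (hk : 0 ≤ k) (hlam : 0 ≤ lam)
    (hθ : 0 ≤ θ) (hz : lam • 1 ≤ normalMatrix A z) (hwz : ∀ j, |w j - z j| ≤ k)
    (hkA : k * ‖A‖ ≤ θ * √lam) (y : Fin m → ℝ) :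
    |euclNorm (w * (Aᵀ *ᵥ y)) - euclNorm (z * (Aᵀ *ᵥ y))| ≤ θ * euclNorm (z * (Aᵀ *ᵥ y)) :=
  calc |euclNorm (w * (Aᵀ *ᵥ y)) - euclNorm (z * (Aᵀ *ᵥ y))|
      ≤ euclNorm ((w - z) * (Aᵀ *ᵥ y)) := by
        rw [sub_mul]
        exact abs_euclNorm_sub_le _ _
    _ ≤ k * euclNorm (Aᵀ *ᵥ y) := euclNorm_mul_le hk hwz _
    _ ≤ k * (‖A‖ * euclNorm y) := by gcongr; exact euclNorm_transpose_mulVec_le A y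
    _ = k * ‖A‖ * euclNorm y := (mul_assoc _ _ _).symm
    _ ≤ θ * √lam * euclNorm y := by gcongr; exact euclNorm_nonneg y
    _ = θ * (√lam * euclNorm y) := mul_assoc _ _ _
    _ ≤ θ * euclNorm (z * (Aᵀ *ᵥ y)) := by gcongr; exact sqrt_mul_euclNorm_le hlam hz y

theorem smul_normalMatrix_le {k lam θ : ℝ} (hk : 0 ≤ k) (hlam : 0 ≤ lam) (hθ : 0 ≤ θ)
    (hθ_le : θ ≤ 1) (hz : lam • 1 ≤ normalMatrix A z) (hwz : ∀ j, |w j - z j| ≤ k)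
    (hkA : k * ‖A‖ ≤ θ * √lam) : (1 - θ) ^ 2 • normalMatrix A z ≤ normalMatrix A w := by
  rw [loewner_le_iff ((normalMatrix_isHermitian A z).smul (.all _)) (normalMatrix_isHermitian A w)]
  intro y
  have hdist := abs_le.1 (abs_euclNorm_mul_transpose_mulVec_sub_le hk hlam hθ hz hwz hkA y)
  rw [Matrix.smul_mulVec, dotProduct_smul, smul_eq_mul, dotProduct_normalMatrix_mulVec,
    dotProduct_normalMatrix_mulVec, ← mul_pow]
  exact pow_le_pow_left₀ (mul_nonneg (sub_nonneg.2 hθ_le) (euclNorm_nonneg _)) (by linarith) 2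

theorem normalMatrix_le_smul {k lam θ : ℝ} (hk : 0 ≤ k) (hlam : 0 ≤ lam) (hθ : 0 ≤ θ)
    (hz : lam • 1 ≤ normalMatrix A z) (hwz : ∀ j, |w j - z j| ≤ k)
    (hkA : k * ‖A‖ ≤ θ * √lam) : normalMatrix A w ≤ (1 + θ) ^ 2 • normalMatrix A z := by
  rw [loewner_le_iff (normalMatrix_isHermitian A w) ((normalMatrix_isHermitian A z).smul (.all _))]
  intro y
  have hdist := abs_le.1 (abs_euclNorm_mul_transpose_mulVec_sub_le hk hlam hθ hz hwz hkA y)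
  rw [Matrix.smul_mulVec, dotProduct_smul, smul_eq_mul, dotProduct_normalMatrix_mulVec,
    dotProduct_normalMatrix_mulVec, ← mul_pow]
  exact pow_le_pow_left₀ (euclNorm_nonneg _) (by linarith) 2

end NormalMatrix

section Direction

variable {m n : ℕ} {A : Matrix (Fin m) (Fin n) ℝ} {x w : Fin n → ℝ} {k : ℝ}

/-- The projected direction `- W P_{AW} g`. The Newton direction at `x` is the case `w = x`,
`g = v` of the residual vector `v`, and the surrogate direction is the case
`g = W X⁻¹ v = (1/μ) W c - W X⁻¹ e`. -/
noncomputable def projectedDirection (A : Matrix (Fin m) (Fin n) ℝ) (w g : Fin n → ℝ) : Fin n → ℝ :=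
  -(w * (kerProj (A * Matrix.diagonal w) *ᵥ g))

theorem newtonDirection_eq_projectedDirection (A : Matrix (Fin m) (Fin n) ℝ) (c x : Fin n → ℝ)
    (μ : ℝ) : newtonDirection A c x μ = projectedDirection A x (barrierResidual c x μ) := by
  ext j
  rw [newtonDirection, projectedDirection, Pi.neg_apply, Pi.neg_apply, Matrix.mulVec_diagonal,
    Pi.mul_apply]

theorem abs_le_of_abs_sub_one_le {t : ℝ} (ht : |t - 1| ≤ k) (hk : k ≤ 1 / 4) : |t| ≤ 5 / 4 := by
  have := abs_le.1 ht
  exact abs_le.2 ⟨by linarith, by linarith⟩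

theorem pos_of_abs_sub_one_le {t : ℝ} (ht : |t - 1| ≤ k) (hk : k ≤ 1 / 4) : 0 < t := by
  linarith [(abs_le.1 ht).1]

theorem ne_zero_of_abs_div_sub_one_le {s t : ℝ} (hst : |s / t - 1| ≤ k) (hk : k ≤ 1 / 4) : s ≠ 0 :=
  fun hs => (pos_of_abs_sub_one_le hst hk).ne' (by rw [hs, zero_div])

theorem abs_sub_inv_le {t : ℝ} (ht : |t - 1| ≤ k) (hk : k ≤ 1 / 4) : |t - t⁻¹| ≤ 12 / 5 * k := by
  have htpos := pos_of_abs_sub_one_le ht hk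
  have hinv : t⁻¹ ≤ 7 / 5 := by
    rw [inv_le_comm₀ htpos (by norm_num)]
    linarith [(abs_le.1 ht).1]
  calc |t - t⁻¹| = |(t - 1) * (1 + t⁻¹)| := by
        congr 1
        field_simp
        ring
    _ = |t - 1| * (1 + t⁻¹) := by rw [abs_mul, abs_of_pos (by positivity : 0 < 1 + t⁻¹)]
    _ ≤ k * (12 / 5) := by
        gcongr
        · exact (abs_nonneg _).trans ht
        · linarith
    _ = 12 / 5 * k := mul_comm _ _

theorem scaledNorm_projectedDirection_sub_le (hA : A.rank = m) (hx : ∀ j, x j ≠ 0) (hk : 0 ≤ k)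
    (hk_le : k ≤ 1 / 4) (hwx : ∀ j, |w j / x j - 1| ≤ k) (v : Fin n → ℝ) :
    scaledNorm x (projectedDirection A x v - projectedDirection A w (w / x * v)) ≤
      3 * k * euclNorm (kerProj (A * Matrix.diagonal x) *ᵥ v) := by
  have hd (j) : (w / x) j ≠ 0 := (pos_of_abs_sub_one_le (hwx j) hk_le).ne'
  have hw (j) : w j ≠ 0 := ne_zero_of_abs_div_sub_one_le (hwx j) hk_le
  have hcomp : A * Matrix.diagonal x * Matrix.diagonal (w / x) = A * Matrix.diagonal w := by
    rw [Matrix.mul_assoc, Matrix.diagonal_mul_diagonal]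
    congr 2
    exact funext fun j => mul_div_cancel₀ _ (hx j)
  have hBw := isUnit_det_mul_diagonal hA hw
  have hrescale := mul_kerProj_mul_diagonal_mulVec_sub hd (isUnit_det_mul_diagonal hA hx)
    (hcomp ▸ hBw) v
  rw [hcomp] at hrescale
  set p := kerProj (A * Matrix.diagonal x) *ᵥ v
  have hscaled : (fun j => (x j)⁻¹ *
      (projectedDirection A x v - projectedDirection A w (w / x * v)) j) =
        w / x * (kerProj (A * Matrix.diagonal w) *ᵥ ((w / x - (w / x)⁻¹) * p)) := by
    rw [← hrescale]
    ext j
    simp only [projectedDirection, Pi.sub_apply, Pi.neg_apply, Pi.mul_apply, Pi.div_apply]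
    field_simp [hx j]
    ring
  calc scaledNorm x (projectedDirection A x v - projectedDirection A w (w / x * v))
      = euclNorm (w / x * (kerProj (A * Matrix.diagonal w) *ᵥ ((w / x - (w / x)⁻¹) * p))) :=
        congrArg euclNorm hscaled
    _ ≤ 5 / 4 * euclNorm (kerProj (A * Matrix.diagonal w) *ᵥ ((w / x - (w / x)⁻¹) * p)) :=
        euclNorm_mul_le (by norm_num) (fun j => abs_le_of_abs_sub_one_le (hwx j) hk_le) _
    _ ≤ 5 / 4 * euclNorm ((w / x - (w / x)⁻¹) * p) := by
        gcongr
        exact euclNorm_kerProj_mulVec_le hBw _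
    _ ≤ 5 / 4 * (12 / 5 * k * euclNorm p) := by
        gcongr
        exact euclNorm_mul_le (by positivity) (fun j => abs_sub_inv_le (hwx j) hk_le) _
    _ = 3 * k * euclNorm p := by ring

theorem projectedDirection_sub_eq (hA : A.rank = m) (hw : ∀ j, w j ≠ 0) (g : Fin n → ℝ)
    (y : Fin m → ℝ) :
    projectedDirection A w g - (w * w * (Aᵀ *ᵥ y) - w * g) =
      w * ((A * Matrix.diagonal w)ᵀ *ᵥ (normalMatrix A w)⁻¹ *ᵥ
        (A *ᵥ (w * g) - normalMatrix A w *ᵥ y)) := by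
  rw [Matrix.mulVec_sub, inv_mulVec_mulVec (isUnit_det_of_posDef (normalMatrix_posDef hA hw)),
    Matrix.mulVec_sub, ← mul_diagonal_mulVec, projectedDirection, kerProj_mulVec,
    ← normalMatrix_eq_mul_transpose, transpose_mul_diagonal_mulVec _ _ y]
  ring

theorem scaledNorm_projectedDirection_sub_sub_le (hA : A.rank = m) (hw : ∀ j, w j ≠ 0)
    (hk : 0 ≤ k) (hwx : ∀ j, |w j / x j| ≤ k) (g : Fin n → ℝ) (y : Fin m → ℝ) :
    scaledNorm x (projectedDirection A w g - (w * w * (Aᵀ *ᵥ y) - w * g)) ≤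
      k * √(dualNormSq (normalMatrix A w) (A *ᵥ (w * g) - normalMatrix A w *ᵥ y)) := by
  set r := A *ᵥ (w * g) - normalMatrix A w *ᵥ y with hr
  have hscaled : (fun j => (x j)⁻¹ *
      (projectedDirection A w g - (w * w * (Aᵀ *ᵥ y) - w * g)) j) =
        w / x * ((A * Matrix.diagonal w)ᵀ *ᵥ (normalMatrix A w)⁻¹ *ᵥ r) := by
    rw [projectedDirection_sub_eq hA hw, ← hr]
    ext j
    simp only [Pi.mul_apply, Pi.div_apply]
    ring
  rw [scaledNorm, hscaled, normalMatrix_eq_mul_transpose,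
    ← euclNorm_transpose_inv_mulVec_sq (isUnit_det_mul_diagonal hA hw),
    Real.sqrt_sq (euclNorm_nonneg _)]
  exact euclNorm_mul_le hk hwx _

end Direction

section DelayedPoint

variable {n : ℕ} {x z : Fin n → ℝ} {ν : ℝ}

theorem thresholdedDist_nonneg (x : Fin n → ℝ) (ν : ℝ) (y z : Fin n → ℝ) :
    0 ≤ thresholdedDist x ν y z := Real.sqrt_nonneg _

theorem abs_inv_mul_sub_le_thresholdedDist (y z : Fin n → ℝ) {j : Fin n} (hj : ν ≤ x j) :
    |(x j)⁻¹ * (y j - z j)| ≤ thresholdedDist x ν y z := by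
  refine Real.abs_le_sqrt (le_add_of_le_of_nonneg ?_ (Finset.sum_nonneg fun _ _ => sq_nonneg _))
  exact Finset.single_le_sum (f := fun i => ((x i)⁻¹ * (y i - z i)) ^ 2)
    (fun i _ => sq_nonneg _) (Finset.mem_filter.2 ⟨Finset.mem_univ j, hj⟩)

theorem abs_sub_le_thresholdedDist (y z : Fin n → ℝ) {j : Fin n} (hj : x j < ν) :
    |y j - z j| ≤ thresholdedDist x ν y z := by
  refine Real.abs_le_sqrt (le_add_of_nonneg_of_le (Finset.sum_nonneg fun _ _ => sq_nonneg _) ?_)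
  exact Finset.single_le_sum (f := fun i => (y i - z i) ^ 2)
    (fun i _ => sq_nonneg _) (Finset.mem_filter.2 ⟨Finset.mem_univ j, hj⟩)

theorem delayedPoint_val_apply (ν : ℝ) (x z : Fin n → ℝ) (j : Fin n) :
    (delayedPoint ν x z).val j = if ν ≤ x j then z j else x j := by
  simp [delayedPoint]

theorem abs_delayedPoint_div_sub_one_le {j : Fin n} (hx : x j ≠ 0) :
    |(delayedPoint ν x z).val j / x j - 1| ≤ thresholdedDist x ν z x := by
  rw [delayedPoint_val_apply]
  split_ifs with h
  · refine le_of_eq_of_le (congrArg _ ?_) (abs_inv_mul_sub_le_thresholdedDist z x h)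
    field_simp
  · rw [div_self hx, sub_self, abs_zero]
    exact thresholdedDist_nonneg _ _ _ _

theorem abs_delayedPoint_sub_le (j : Fin n) :
    |(delayedPoint ν x z).val j - z j| ≤ thresholdedDist x ν z x := by
  rw [delayedPoint_val_apply]
  split_ifs with h
  · rw [sub_self, abs_zero]
    exact thresholdedDist_nonneg _ _ _ _
  · rw [abs_sub_comm]
    exact abs_sub_le_thresholdedDist z x (not_le.1 h)

end DelayedPoint

section Complexity

theorem pow_mul_sq_le_of_log_le {V ε : ℝ} (hV : 0 ≤ V) (hε : 0 < ε) {K : ℕ}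
    (hK : 81 * Real.log (2 + V / ε) ≤ K) :
    25 * (9 / 4) * ((8 / 9) ^ K * (5 / 4 * V) ^ 2) ≤ ε ^ 2 := by
  set t := V / ε with ht
  have ht0 : 0 ≤ t := div_nonneg hV hε.le
  have hdecay : (8 / 9 : ℝ) ^ K ≤ ((2 + t) ^ 9)⁻¹ :=
    calc (8 / 9 : ℝ) ^ K ≤ Real.exp (-(1 / 9)) ^ K := by
          gcongr
          linarith [Real.add_one_le_exp (-(1 / 9) : ℝ)]
      _ = Real.exp (K * -(1 / 9)) := (Real.exp_nat_mul _ _).symm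
      _ ≤ Real.exp (-((9 : ℕ) * Real.log (2 + t))) := by
          gcongr
          push_cast
          linarith
      _ = ((2 + t) ^ 9)⁻¹ := by
          rw [Real.exp_neg, Real.exp_nat_mul, Real.exp_log (by positivity)]
  -- The exponent 9 absorbs the constants: `25 (9/4) (5/4)² ≤ 2⁷ ≤ (2 + t)⁷`.
  have hgrowth : 25 * (9 / 4) * (5 / 4) ^ 2 * t ^ 2 ≤ (2 + t) ^ 9 :=
    calc 25 * (9 / 4) * (5 / 4) ^ 2 * t ^ 2 ≤ 2 ^ 7 * t ^ 2 := by gcongr; norm_num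
      _ ≤ (2 + t) ^ 7 * (2 + t) ^ 2 := by gcongr <;> linarith
      _ = (2 + t) ^ 9 := by ring
  calc 25 * (9 / 4) * ((8 / 9) ^ K * (5 / 4 * V) ^ 2)
      ≤ 25 * (9 / 4) * (((2 + t) ^ 9)⁻¹ * (5 / 4 * V) ^ 2) := by gcongr
    _ = 25 * (9 / 4) * (5 / 4) ^ 2 * t ^ 2 / (2 + t) ^ 9 * ε ^ 2 := by
        rw [ht]
        field_simp
    _ ≤ 1 * ε ^ 2 := by
        gcongr
        exact div_le_one_of_le₀ hgrowth (by positivity)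
    _ = ε ^ 2 := one_mul _

theorem half_le_log_two_add {t : ℝ} (ht : 0 ≤ t) : 1 / 2 ≤ Real.log (2 + t) := by
  have : Real.log 2 ≤ Real.log (2 + t) := Real.log_le_log (by norm_num) (by linarith)
  linarith [Real.log_two_gt_d9]

theorem log_two_add_div_le {V ε : ℝ} (hV : 0 ≤ V) (hε : 0 < ε) (hε_le : ε ≤ 1 / 2) :
    Real.log (2 + V / ε) ≤ 3 * (Real.log (2 + V) * Real.log (1 / ε)) := by
  have hinv : 2 ≤ 1 / ε := by
    rw [le_div_iff₀ hε]
    linarith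
  have hadd : Real.log (2 + V / ε) ≤ Real.log (2 + V) + Real.log (1 / ε) := by
    rw [← Real.log_mul (by positivity) (by positivity)]
    apply Real.log_le_log (by positivity)
    calc 2 + V / ε = 2 + V * (1 / ε) := by ring
      _ ≤ (2 + V) * (1 / ε) := by linarith
  have hV_log : Real.log 2 ≤ Real.log (2 + V) := Real.log_le_log (by norm_num) (by linarith)
  have hε_log : Real.log 2 ≤ Real.log (1 / ε) := Real.log_le_log (by norm_num) hinv
  nlinarith [Real.log_two_gt_d9]

theorem cost_le_sq_mul {m n : ℕ} (hn : 0 < n) (hmn : m ≤ n) (K : ℕ) :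
    8 * n + 4 * m * n + 4 * m ^ 2 + 6 * m + (3 + K * (4 * m * n + n + 4 * m ^ 2 + 14 * m + 6)) ≤
      n ^ 2 * (25 + 29 * K) := by
  have hone : 1 ≤ n ^ 2 := Nat.one_le_pow _ _ hn
  have hn_sq : n ≤ n ^ 2 := Nat.le_self_pow two_ne_zero n
  have hmn_sq : m * n ≤ n ^ 2 := by
    rw [sq]
    exact Nat.mul_le_mul_right n hmn
  have hm_sq : m ^ 2 ≤ n ^ 2 := Nat.pow_le_pow_left hmn 2
  have hstep : K * (4 * m * n + n + 4 * m ^ 2 + 14 * m + 6) ≤ K * (29 * n ^ 2) :=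
    Nat.mul_le_mul_left _ (by rw [mul_assoc]; omega)
  rw [mul_assoc 4 m n] at hstep ⊢
  linarith

theorem natCast_le_of_le_cost {m n T : ℕ} {l : ℝ} (hn : 0 < n) (hmn : m ≤ n) (hl : 1 / 2 ≤ l)
    (hT : T ≤ 8 * n + 4 * m * n + 4 * m ^ 2 + 6 * m +
      (3 + ⌈81 * l⌉₊ * (4 * m * n + n + 4 * m ^ 2 + 14 * m + 6))) :
    (T : ℝ) ≤ 2500 * (n : ℝ) ^ 2 * l := by
  have hceil : (⌈81 * l⌉₊ : ℝ) < 81 * l + 1 := Nat.ceil_lt_add_one (by linarith)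
  calc (T : ℝ) ≤ (n : ℝ) ^ 2 * (25 + 29 * (⌈81 * l⌉₊ : ℝ)) := by
        exact_mod_cast hT.trans (cost_le_sq_mul hn hmn _)
    _ ≤ (n : ℝ) ^ 2 * (2500 * l) := by
        gcongr
        linarith
    _ = 2500 * (n : ℝ) ^ 2 * l := by ring

end Complexity

section DelayedDirection

open scoped MatrixOrder

variable {m n : ℕ} {A : Matrix (Fin m) (Fin n) ℝ} {c x z w : Fin n → ℝ}
  {L : Matrix (Fin m) (Fin m) ℝ} {k μ ν ε lam : ℝ}

theorem sq_mul_sub_eq_mul_barrierResidual (hx : ∀ j, x j ≠ 0) :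
    (fun j => w j * w j * (c j / μ - 1 / x j)) = w * (w / x * barrierResidual c x μ) := by
  ext j
  simp only [barrierResidual, Pi.mul_apply, Pi.div_apply, Pi.sub_apply, Pi.smul_apply,
    Pi.one_apply, Matrix.mulVec_diagonal, smul_eq_mul]
  field_simp [hx j]

theorem delayedDirection_eq_of_pcgLoop_eq (hx : ∀ j, x j ≠ 0) (hw : (delayedPoint ν x z).val = w)
    {K T : ℕ} {d : Fin m → ℝ}
    (hloop : pcgLoop A (w * w) L ε K
      (pcgInit L (A *ᵥ (w * (w / x * barrierResidual c x μ)))).val = ⟨some d, T⟩) :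
    delayedDirection A c μ ν ε x z L K =
      ⟨some (w * w * (Aᵀ *ᵥ d) - w * (w / x * barrierResidual c x μ)),
        8 * n + 4 * m * n + 4 * m ^ 2 + 6 * m + T⟩ := by
  rw [← sq_mul_sub_eq_mul_barrierResidual hx] at hloop ⊢
  have hq : (fun j => w j * w j) = w * w := rfl
  ext1 <;>
    simp only [delayedDirection, bind_val, bind_ops, hw, vec_val, mul_val, mulVec_val, sub_val,
      div_val, hq, hloop, vec_ops, mul_ops, div_ops, sub_ops, mulVec_ops, pcgInit_ops, pure_val,
      pure_ops]
  · rfl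
  · simp only [delayedPoint, vec_ops, bind_ops, le_ops, le_val, decide_eq_true_eq, pure_ops,
      add_zero, Finset.sum_const, Finset.card_univ, Fintype.card_fin, smul_eq_mul, mul_one]
    ring

theorem dualNormSq_mulVec_mul_le (hA : A.rank = m) (hw : ∀ j, w j ≠ 0) (hk : 0 ≤ k)
    (hwx : ∀ j, |w j / x j| ≤ k) (v : Fin n → ℝ) :
    dualNormSq (normalMatrix A w) (A *ᵥ (w * (w / x * v))) ≤ (k * euclNorm v) ^ 2 := by
  rw [normalMatrix_eq_mul_transpose, ← mul_diagonal_mulVec]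
  refine (dualNormSq_mulVec_le (isUnit_det_mul_diagonal hA hw) _).trans ?_
  exact pow_le_pow_left₀ (euclNorm_nonneg _) (euclNorm_mul_le hk hwx _) 2

theorem scaledNorm_newtonDirection_sub_le (hA : A.rank = m) (hx : ∀ j, x j ≠ 0) (hk : 0 ≤ k)
    (hk_le : k ≤ 1 / 4) (hwx : ∀ j, |w j / x j - 1| ≤ k) (hε : 0 ≤ ε)
    (hprox : k * (6 * proximity A c x μ) ≤ ε) {d : Fin m → ℝ}
    (hres : 25 * dualNormSq (normalMatrix A w)
      (A *ᵥ (w * (w / x * barrierResidual c x μ)) - normalMatrix A w *ᵥ d) ≤ 4 * ε ^ 2) :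
    scaledNorm x (newtonDirection A c x μ -
      (w * w * (Aᵀ *ᵥ d) - w * (w / x * barrierResidual c x μ))) ≤ ε := by
  have hw (j) : w j ≠ 0 := ne_zero_of_abs_div_sub_one_le (hwx j) hk_le
  set v := barrierResidual c x μ
  have hres_sqrt : √(dualNormSq (normalMatrix A w)
      (A *ᵥ (w * (w / x * v)) - normalMatrix A w *ᵥ d)) ≤ 2 / 5 * ε :=
    Real.sqrt_le_iff.2 ⟨by positivity, by linarith⟩
  calc scaledNorm x (newtonDirection A c x μ - (w * w * (Aᵀ *ᵥ d) - w * (w / x * v)))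
      ≤ scaledNorm x (newtonDirection A c x μ - projectedDirection A w (w / x * v)) +
          scaledNorm x (projectedDirection A w (w / x * v) -
            (w * w * (Aᵀ *ᵥ d) - w * (w / x * v))) := scaledNorm_sub_le _ _ _ _
    _ ≤ 3 * k * proximity A c x μ + 5 / 4 * (2 / 5 * ε) := by
        rw [newtonDirection_eq_projectedDirection]
        refine add_le_add (scaledNorm_projectedDirection_sub_le hA hx hk hk_le hwx v) ?_
        refine (scaledNorm_projectedDirection_sub_sub_le hA hw (by norm_num)
          (fun j => abs_le_of_abs_sub_one_le (hwx j) hk_le) _ d).trans ?_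
        gcongr
    _ ≤ ε := by linarith

theorem exists_pcgLoop_eq_of_smul_one_le (hA : A.rank = m) (hlam : 0 ≤ lam) (hw : ∀ j, w j ≠ 0)
    (hz : ∀ j, z j ≠ 0) (hlamz : lam • 1 ≤ normalMatrix A z)
    (hL : IsTriangularFactor L (normalMatrix A z)) (hk : 0 ≤ k) (hwz : ∀ j, |w j - z j| ≤ k)
    (hkA : k * (2 * ‖A‖) ≤ √lam) {h : Fin m → ℝ} {K : ℕ}
    (hK : 25 * (9 / 4) * ((8 / 9) ^ K * dualNormSq (normalMatrix A w) h) ≤ ε ^ 2) :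
    ∃ (d : Fin m → ℝ) (T : ℕ),
      (∀ maxIter, K ≤ maxIter →
        pcgLoop A (w * w) L ε maxIter (pcgInit L h).val = ⟨some d, T⟩) ∧
      T ≤ 3 + K * (4 * m * n + n + 4 * m ^ 2 + 14 * m + 6) ∧
      25 * dualNormSq (normalMatrix A w) (h - normalMatrix A w *ᵥ d) ≤ 4 * ε ^ 2 := by
  have hMz := normalMatrix_posDef hA hz
  have hMw := normalMatrix_posDef hA hw
  have hkA_half : k * ‖A‖ ≤ 1 / 2 * √lam := by linarith
  have hlower := smul_normalMatrix_le hk hlam (by norm_num) (by norm_num) hlamz hwz hkA_half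
  have hupper := normalMatrix_le_smul hk hlam (by norm_num) hlamz hwz hkA_half
  norm_num at hlower hupper
  have hinit := isPCGIterate_pcgInit hL (isUnit_det_of_posDef hMz) (normalMatrix A w) h
  have hstart : 25 * (9 / 4) * ((1 - 1 / 4 / (9 / 4)) ^ K *
      dualNormSq (normalMatrix A w) (pcgInit L h).val.r) ≤ ε ^ 2 := by
    norm_num at hK ⊢
    exact hK
  rw [normalMatrix_eq_mul_diagonal_mul A w] at hMw hlower hupper hinit hstart ⊢
  obtain ⟨d, T, hrun, hT, hres⟩ := hinit.exists_pcgLoop_eq hMw hMz hL (by norm_num)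
    (by norm_num) (by norm_num) hlower hupper hstart
  refine ⟨d, T, hrun, hT, ?_⟩
  have := mul_dualNormSq_le_of_smul_le hMw hMz (by norm_num) hlower
    (h - (A * Matrix.diagonal (w * w) * Aᵀ) *ᵥ d)
  linarith

theorem exists_delayedDirection_eq (hA : A.rank = m) (hε : 0 < ε) (hlam : 0 ≤ lam)
    (hx : ∀ j, x j ≠ 0) (hz : ∀ j, z j ≠ 0) (hlamz : lam • 1 ≤ normalMatrix A z)
    (hL : IsTriangularFactor L (normalMatrix A z))
    (hdist : thresholdedDist x ν z x * (2 * ‖A‖) ≤ √lam)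
    (hquarter : thresholdedDist x ν z x ≤ 1 / 4)
    (hprox : thresholdedDist x ν z x * (6 * proximity A c x μ) ≤ ε) {K : ℕ}
    (hK : 81 * Real.log (2 + euclNorm (barrierResidual c x μ) / ε) ≤ K) :
    ∃ (dx : Fin n → ℝ) (T : ℕ),
      (∀ maxIter, K ≤ maxIter → delayedDirection A c μ ν ε x z L maxIter = ⟨some dx, T⟩) ∧
      scaledNorm x (newtonDirection A c x μ - dx) ≤ ε ∧
      T ≤ 8 * n + 4 * m * n + 4 * m ^ 2 + 6 * m +
        (3 + K * (4 * m * n + n + 4 * m ^ 2 + 14 * m + 6)) := by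
  obtain ⟨w, hw⟩ : ∃ w, (delayedPoint ν x z).val = w := ⟨_, rfl⟩
  have hk : 0 ≤ thresholdedDist x ν z x := thresholdedDist_nonneg _ _ _ _
  have hwz (j) : |w j - z j| ≤ thresholdedDist x ν z x := hw ▸ abs_delayedPoint_sub_le j
  have hwx (j) : |w j / x j - 1| ≤ thresholdedDist x ν z x :=
    hw ▸ abs_delayedPoint_div_sub_one_le (hx j)
  have hw_ne (j) : w j ≠ 0 := ne_zero_of_abs_div_sub_one_le (hwx j) hquarter
  have henergy := dualNormSq_mulVec_mul_le hA hw_ne (by norm_num)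
    (fun j => abs_le_of_abs_sub_one_le (hwx j) hquarter) (barrierResidual c x μ)
  obtain ⟨d, T, hrun, hT, hres⟩ := exists_pcgLoop_eq_of_smul_one_le hA hlam hw_ne hz hlamz hL hk hwz
    hdist (le_trans (by gcongr) (pow_mul_sq_le_of_log_le (euclNorm_nonneg _) hε hK))
  exact ⟨_, _, fun maxIter hmax => delayedDirection_eq_of_pcgLoop_eq hx hw (hrun maxIter hmax),
    scaledNorm_newtonDirection_sub_le hA hx hk hquarter hwx hε.le hprox hres,
    Nat.add_le_add_left hT _⟩

end DelayedDirection

end PrimalIPM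

theorem mainTheorem5_general :
    ∃ C : ℝ, 0 < C ∧
      ∀ (m n : ℕ) (A : Matrix (Fin m) (Fin n) ℝ) (c x z : Fin n → ℝ)
        (L : Matrix (Fin m) (Fin m) ℝ) (μ ν ε lamz : ℝ),
        0 < n → A.rank = m →
        μ ≠ 0 → 0 < ε → 0 ≤ lamz →
        (∀ j, x j ≠ 0) → (∀ j, z j ≠ 0) →
        (normalMatrix A z - lamz • (1 : Matrix (Fin m) (Fin m) ℝ)).PosSemidef →
        IsTriangularFactor L (normalMatrix A z) →
        thresholdedDist x ν z x * (2 * ‖A‖) ≤ Real.sqrt lamz →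
        thresholdedDist x ν z x ≤ 1 / 4 →
        thresholdedDist x ν z x * (6 * proximity A c x μ) ≤ ε →
        ∃ (dx : Fin n → ℝ) (T N : ℕ),
          (∀ maxIter : ℕ, N ≤ maxIter →
            delayedDirection A c μ ν ε x z L maxIter = ⟨some dx, T⟩) ∧
          scaledNorm x (newtonDirection A c x μ - dx) ≤ ε ∧
          (T : ℝ) ≤ C * (n : ℝ) ^ 2 *
            Real.log (2 + euclNorm (barrierResidual c x μ) / ε) ∧
          (ε ≤ 1 / 2 →
            (T : ℝ) ≤ C * Real.log (2 + euclNorm (barrierResidual c x μ)) *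
              (n : ℝ) ^ 2 * Real.log (1 / ε)) := by
  refine ⟨7500, by norm_num, ?_⟩
  intro m n A c x z L μ ν ε lamz hn hA _ hε hlam hx hz hlamz hL hdist hquarter hprox
  have hV := euclNorm_nonneg (barrierResidual c x μ)
  have hl := half_le_log_two_add (div_nonneg hV hε.le)
  obtain ⟨dx, T, hrun, hacc, hT⟩ := exists_delayedDirection_eq hA hε hlam hx hz
    (Matrix.le_iff.2 hlamz) hL hdist hquarter hprox (Nat.le_ceil _)
  have hcost := natCast_le_of_le_cost hn (hA ▸ A.rank_le_width) hl hT
  refine ⟨dx, T, _, hrun, hacc, hcost.trans (by gcongr; norm_num), fun hε_le => hcost.trans ?_⟩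
  refine (mul_le_mul_of_nonneg_left (log_two_add_div_le hV hε hε_le) (by positivity)).trans_eq ?_
  ring

theorem mainTheorem5 :
    ∃ C : ℝ, 0 < C ∧
      ∀ (m n : ℕ) (A : Matrix (Fin m) (Fin n) ℝ) (b : Fin m → ℝ) (c x z : Fin n → ℝ)
        (L : Matrix (Fin m) (Fin m) ℝ) (μ ν ε lamz : ℝ),
        0 < n → A.rank = m →
        0 < μ → 0 < ν → ν ≤ 1 → 0 < ε → 0 ≤ lamz →
        x ∈ strictlyFeasible A b → z ∈ strictlyFeasible A b →
        (normalMatrix A z - lamz • (1 : Matrix (Fin m) (Fin m) ℝ)).PosSemidef →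
        IsTriangularFactor L (normalMatrix A z) →
        -- `‖z - x‖_{x,ν} ≤ min {√lamz / (2 ‖A‖), 1/4, ε / (6 δ(x, μ))}`, where `a / 0 = ∞`
        thresholdedDist x ν z x * (2 * ‖A‖) ≤ Real.sqrt lamz →
        thresholdedDist x ν z x ≤ 1 / 4 →
        thresholdedDist x ν z x * (6 * proximity A c x μ) ≤ ε →
        ∃ (dx : Fin n → ℝ) (T N : ℕ),
          (∀ maxIter : ℕ, N ≤ maxIter →
            delayedDirection A c μ ν ε x z L maxIter = ⟨some dx, T⟩) ∧
          scaledNorm x (newtonDirection A c x μ - dx) ≤ ε ∧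
          (T : ℝ) ≤ C * (n : ℝ) ^ 2 *
            Real.log (2 + euclNorm (barrierResidual c x μ) / ε) ∧
          (ε ≤ 1 / 2 →
            (T : ℝ) ≤ C * Real.log (2 + euclNorm (barrierResidual c x μ)) *
              (n : ℝ) ^ 2 * Real.log (1 / ε)) := by
  obtain ⟨C, hC, h⟩ := mainTheorem5_general
  exact ⟨C, hC, fun m n A _ c x z L μ ν ε lamz hn hA hμ _ _ hε hlam hx hz =>
    h m n A c x z L μ ν ε lamz hn hA hμ.ne' hε hlam (fun j => (hx.2 j).ne') (fun j => (hz.2 j).ne')⟩
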